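/- All matroids and lattices are finite. For a matroid $M$, let $\mathcal{Z}(M)$ be the lattice, ordered by inclusion, of the cyclic flats of $M$, that is, of the flats $X$ such that the restriction $M|X$ has no isthmuses (coloops). A matroid is \emph{transversal} if its independent sets are the partial transversals of some finite family of subsets of its ground set. The \emph{dimension} of an ordered set $P$ is the least number of chains such that $P$ embeds, as an ordered set, in their product. A lattice $L$ is a \emph{Tr-lattice} if every matroid $M$ with $\mathcal{Z}(M)\cong L$ is transversal. If $\mathcal{Z}(M)$ is distributive and has dimension at most two, then $M$ and all of its minors, as well as the duals of $M$ and of all of its minors, are transversal. In particular, every distributive lattice of dimension at most two is a Tr-lattice. -/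

import Mathlib

universe u v

/-- `EmbedsInChains P n`: the ordered set `P` embeds, as an ordered set, in a product of `n` chains
with the componentwise order. -/
def EmbedsInChains (P : Type u) [PartialOrder P] (n : ℕ) : Prop :=
  ∃ (C : Fin n → Type u) (_ : ∀ i, LinearOrder (C i)), Nonempty (P ↪o ∀ i, C i)

/-- The dimension of an ordered set: the least number of chains such that it embeds in their
product (`⊤` if no finite number of chains suffices). -/
noncomputable def orderDimension (P : Type u) [PartialOrder P] : ℕ∞ :=
  sInf {d : ℕ∞ | ∃ n : ℕ, d = n ∧ EmbedsInChains P n}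

namespace Matroid

/-- `X` is a cyclic flat of `M`: a flat such that the restriction `M | X` has no isthmuses
(coloops). -/
def IsCyclicFlat {α : Type u} (M : Matroid α) (X : Set α) : Prop :=
  M.IsFlat X ∧ ∀ e, ¬ (M.restrict X).IsColoop e

/-- A flat is cyclic exactly if it is a union of circuits. -/
theorem isCyclicFlat_iff {α : Type u} {M : Matroid α} {X : Set α} :
    M.IsCyclicFlat X ↔ M.IsFlat X ∧ ∀ e ∈ X, ∃ C, M.IsCircuit C ∧ C ⊆ X ∧ e ∈ C := by
  refine and_congr_right fun hX => ⟨fun h e he => ?_, fun h e he => ?_⟩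
  · obtain ⟨C, hC, heC⟩ := exists_mem_isCircuit_of_not_isColoop (M := M.restrict X) he (h e)
    rw [restrict_isCircuit_iff hX.subset_ground] at hC
    exact ⟨C, hC.1, hC.2, heC⟩
  · obtain ⟨C, hC, hCX, heC⟩ := h e he.mem_ground
    exact he.notMem_isCircuit (hC.isCircuit_restrict_of_subset hCX) heC

/-- The collection `Z(M)` of cyclic flats of `M`, ordered by inclusion. -/
def CyclicFlats {α : Type u} (M : Matroid α) : Type u := {X : Set α // M.IsCyclicFlat X}

instance CyclicFlats.instPartialOrder {α : Type u} (M : Matroid α) :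
    PartialOrder M.CyclicFlats :=
  inferInstanceAs (PartialOrder {X : Set α // M.IsCyclicFlat X})

/-- The closure of the union of two cyclic flats is a cyclic flat. -/
theorem IsCyclicFlat.closure_union {α : Type u} {M : Matroid α} {X Y : Set α}
    (hX : M.IsCyclicFlat X) (hY : M.IsCyclicFlat Y) : M.IsCyclicFlat (M.closure (X ∪ Y)) := by
  rw [isCyclicFlat_iff] at *
  have hXY : X ∪ Y ⊆ M.closure (X ∪ Y) :=
    M.subset_closure _ (Set.union_subset hX.1.subset_ground hY.1.subset_ground)
  refine ⟨M.isFlat_closure _, fun e he => ?_⟩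
  by_cases hXe : e ∈ X
  · obtain ⟨C, hC, hCX, heC⟩ := hX.2 e hXe
    exact ⟨C, hC, hCX.trans (Set.subset_union_left.trans hXY), heC⟩
  by_cases hYe : e ∈ Y
  · obtain ⟨C, hC, hCY, heC⟩ := hY.2 e hYe
    exact ⟨C, hC, hCY.trans (Set.subset_union_right.trans hXY), heC⟩
  obtain ⟨C, hCs, hC, heC⟩ := exists_isCircuit_of_mem_closure he (by simp [hXe, hYe])
  exact ⟨C, hC, hCs.trans (Set.insert_subset he hXY), heC⟩

/-- The union of the circuits in the intersection of two cyclic flats is a cyclic flat. -/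
theorem IsCyclicFlat.sUnion_circuits {α : Type u} {M : Matroid α} {X Y : Set α}
    (hX : M.IsCyclicFlat X) (hY : M.IsCyclicFlat Y) :
    M.IsCyclicFlat (⋃₀ {C | M.IsCircuit C ∧ C ⊆ X ∩ Y}) := by
  rw [isCyclicFlat_iff]
  have hU : ⋃₀ {C | M.IsCircuit C ∧ C ⊆ X ∩ Y} ⊆ X ∩ Y := Set.sUnion_subset fun C hC => hC.2
  have hE : ⋃₀ {C | M.IsCircuit C ∧ C ⊆ X ∩ Y} ⊆ M.E :=
    hU.trans (Set.inter_subset_left.trans hX.1.subset_ground)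
  refine ⟨?_, fun e ⟨C, hC, heC⟩ => ⟨C, hC.1, Set.subset_sUnion_of_mem hC, heC⟩⟩
  rw [isFlat_iff_closure_eq]
  refine (M.subset_closure _ hE).antisymm' fun e he => ?_
  by_contra hne
  obtain ⟨C, hCs, hC, heC⟩ := exists_isCircuit_of_mem_closure he hne
  have heX : e ∈ X := hX.1.closure ▸ M.closure_subset_closure (hU.trans Set.inter_subset_left) he
  have heY : e ∈ Y := hY.1.closure ▸ M.closure_subset_closure (hU.trans Set.inter_subset_right) he
  exact hne ⟨C, ⟨hC, hCs.trans (Set.insert_subset ⟨heX, heY⟩ hU)⟩, heC⟩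

/-- The lattice of cyclic flats: the join is the closure of the union, and the meet is the union of
the circuits contained in the intersection. -/
instance CyclicFlats.instLattice {α : Type u} (M : Matroid α) : Lattice M.CyclicFlats where
  __ := CyclicFlats.instPartialOrder M
  sup X Y := ⟨M.closure (X.1 ∪ Y.1), X.2.closure_union Y.2⟩
  inf X Y := ⟨⋃₀ {C | M.IsCircuit C ∧ C ⊆ X.1 ∩ Y.1}, X.2.sUnion_circuits Y.2⟩
  le_sup_left X Y := Set.subset_union_left.trans
    (M.subset_closure _ (Set.union_subset X.2.1.subset_ground Y.2.1.subset_ground))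
  le_sup_right X Y := Set.subset_union_right.trans
    (M.subset_closure _ (Set.union_subset X.2.1.subset_ground Y.2.1.subset_ground))
  sup_le X Y Z h h' :=
    (M.closure_subset_closure (Set.union_subset h h')).trans Z.2.1.closure.subset
  inf_le_left X Y := Set.sUnion_subset fun C hC => hC.2.trans Set.inter_subset_left
  inf_le_right X Y := Set.sUnion_subset fun C hC => hC.2.trans Set.inter_subset_right
  le_inf X Y Z h h' := fun e he =>
    let ⟨C, hC, hCX, heC⟩ := (isCyclicFlat_iff.1 X.2).2 e he
    ⟨C, ⟨hC, hCX.trans (Set.subset_inter h h')⟩, heC⟩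

/-- `I` is a partial transversal of the family `A`: there is an injection of `I` into the index set
that sends each `e` in `I` to an index `j` with `e ∈ A j`. -/
def IsPartialTransversal {α : Type u} {ι : Type v} (A : ι → Set α) (I : Set α) : Prop :=
  ∃ f : I → ι, Function.Injective f ∧ ∀ e : I, (e : α) ∈ A (f e)

/-- `M` is transversal: its independent sets are the partial transversals of some finite family of
subsets of its ground set (repetitions and empty sets are allowed). -/
def IsTransversal {α : Type u} (M : Matroid α) : Prop :=
  ∃ (n : ℕ) (A : Fin n → Set α), (∀ j, A j ⊆ M.E) ∧ ∀ I, M.Indep I ↔ IsPartialTransversal A I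

end Matroid

/-- `L` is a Tr-lattice: each (finite) matroid whose lattice of cyclic flats is isomorphic to `L` is
transversal. The ground sets lie in an arbitrary, fixed universe `v`. -/
def IsTrLattice (L : Type u) [Lattice L] : Prop :=
  ∀ (α : Type v) (M : Matroid α), M.Finite → Nonempty (M.CyclicFlats ≃o L) → M.IsTransversal

/-! A set is independent exactly when it meets every cyclic flat in at most rank many elements. For
a minor with ground set `E`, obtained by contracting a set with basis `B`, the bound at a cyclic
flat `F` becomes `ρ = r(F) - |B ∩ F|`, imposed on `φ = F ∩ E`. These bounds are submodular with a
surplus: the elements of `φ x ∩ φ y` outside `φ (x ⊓ y)` are counted too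
(`eRk_closure_union_add_le`).

`isTransversal_of_distribLattice` turns such bounds into a family of sets. Let `z x ≥ x` minimize
`ρ` above `x`, and let `β` be the Möbius inverse of `N - ρ (z x)` over upper sets. Dimension two
reduces inclusion-exclusion above `x` to two elements, so supermodularity gives `β ≥ 0`
(`nonneg_of_sum_Ici_eq`). The family takes `β y` copies of the complement of `φ (z y)`. Hall's
condition for it is equivalent to the bounds, by `exists_add_ncard_le_sub_sum`.

Duals follow because complementation reverses the lattice of cyclic flats. -/

section Sums

/-! ### Möbius inversion and submodularity in dimension two. -/

open scoped Classical in
/-- Möbius inversion over the upper sets `Set.Ici x` of a finite ordered set. -/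
theorem exists_sum_Ici_eq {L : Type*} [PartialOrder L] [Fintype L] (g : L → ℤ) :
    ∃ β : L → ℤ, ∀ x, ∑ y with x ≤ y, β y = g x := by
  have wf : WellFounded (fun a b : L => b < a) := wellFounded_gt
  let β : L → ℤ := wf.fix fun x ih => g x - ∑ y : {y // x < y}, ih y.1 y.2
  refine ⟨β, fun x => ?_⟩
  have hx : β x = g x - ∑ y : {y // x < y}, β y.1 := wf.fix_eq _ x
  have hfil : (Finset.univ.filter fun y => x ≤ y) =
      insert x (Finset.univ.filter fun y => x < y) := by
    ext y
    simp [le_iff_eq_or_lt, eq_comm]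
  rw [hfil, Finset.sum_insert (by simp), hx, ← Finset.sum_subtype_eq_sum_filter]
  simp [Finset.subtype_univ]

variable {L : Type*} [DistribLattice L] {C₁ C₂ : Type*} [LinearOrder C₁] [LinearOrder C₂]
  {f₁ : L → C₁} {f₂ : L → C₂}

/-- In a distributive lattice of dimension at most two, the elements above `x` other than `x`
are those above one of two elements, both of them covers of `x` if they differ. -/
theorem exists_two_covers [Finite L] (hf : ∀ x y, x ≤ y ↔ f₁ x ≤ f₁ y ∧ f₂ x ≤ f₂ y)
    {x : L} (hx : ∃ y, x < y) :
    ∃ a b, x < a ∧ x < b ∧ (a ≠ b → a ⊓ b = x) ∧ ∀ y, x < y → a ≤ y ∨ b ≤ y := by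
  -- Each of `a` and `b` is extreme in one coordinate; the lexicographic tie-break makes it a cover
  -- of `x`.
  obtain ⟨a, ha, ha'⟩ := Set.exists_min_image {y | x < y} (fun y => toLex (f₂ y, f₁ y))
    (Set.toFinite _) hx
  obtain ⟨b, hb, hb'⟩ := Set.exists_min_image {y | x < y} (fun y => toLex (f₁ y, f₂ y))
    (Set.toFinite _) hx
  simp only [Set.mem_ofPred_eq, Prod.Lex.toLex_le_toLex] at ha ha' hb hb'
  have hA : ∀ y, x < y → y ≤ a → y = a := fun y hxy hya => hya.antisymm <| by
    have h := (hf _ _).1 hya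
    rcases ha' y hxy with h' | h'
    · exact absurd h.2 h'.not_ge
    · exact (hf _ _).2 ⟨h'.2, h'.1.le⟩
  have hB : ∀ y, x < y → y ≤ b → y = b := fun y hxy hyb => hyb.antisymm <| by
    have h := (hf _ _).1 hyb
    rcases hb' y hxy with h' | h'
    · exact absurd h.1 h'.not_ge
    · exact (hf _ _).2 ⟨h'.1.le, h'.2⟩
  have hA' : ∀ y, x < y → ¬ a ≤ y → y ⊓ a = x := fun y hxy hay => by
    by_contra hne
    exact hay <| inf_eq_right.1 <|
      hA _ ((le_inf hxy.le ha.le).lt_of_ne (Ne.symm hne)) inf_le_right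
  have hB' : ∀ y, x < y → ¬ b ≤ y → y ⊓ b = x := fun y hxy hby => by
    by_contra hne
    exact hby <| inf_eq_right.1 <|
      hB _ ((le_inf hxy.le hb.le).lt_of_ne (Ne.symm hne)) inf_le_right
  refine ⟨a, b, ha, hb, fun hne => hB' a ha fun h => hne ((hA b hb h).symm), fun y hy => ?_⟩
  by_contra! hcon
  have h₁ : f₁ b ≤ f₁ y := (hb' y hy).elim le_of_lt fun h => h.1.le
  have h₂ : f₂ a ≤ f₂ y := (ha' y hy).elim le_of_lt fun h => h.1.le
  have h₁' : f₁ y ≤ f₁ a := le_of_not_ge fun h => hcon.1 ((hf _ _).2 ⟨h, h₂⟩)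
  have h₂' : f₂ y ≤ f₂ b := le_of_not_ge fun h => hcon.2 ((hf _ _).2 ⟨h₁, h⟩)
  -- Both coordinates of `y` lie between those of `a` and `b`, so distributivity forces `y = (y ⊓ a)
  -- ⊔ (y ⊓ b) = x`.
  have hle : y ≤ a ⊔ b := (hf _ _).2
    ⟨h₁'.trans ((hf _ _).1 le_sup_left).1, h₂'.trans ((hf _ _).1 le_sup_right).2⟩
  refine hy.ne' ?_
  rw [← inf_eq_left.2 hle, inf_sup_left, hA' y hy hcon.1, hB' y hy hcon.2, sup_idem]

open scoped Classical in
/-- The Möbius inverse of a nonnegative, antitone, supermodular function on a distributive lattice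
of dimension at most two is nonnegative. -/
theorem nonneg_of_sum_Ici_eq [Fintype L] (hf : ∀ x y, x ≤ y ↔ f₁ x ≤ f₁ y ∧ f₂ x ≤ f₂ y)
    {g β : L → ℤ} (hβ : ∀ x, ∑ y with x ≤ y, β y = g x) (hg : ∀ x, 0 ≤ g x) (hanti : Antitone g)
    (hsup : ∀ x y, g x + g y ≤ g (x ⊔ y) + g (x ⊓ y)) (x : L) : 0 ≤ β x := by
  have hfil : (Finset.univ.filter fun y => x ≤ y) =
      insert x (Finset.univ.filter fun y => x < y) := by
    ext y
    simp [le_iff_eq_or_lt, eq_comm]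
  have hsum : β x + ∑ y with x < y, β y = g x := by
    rw [← hβ x, hfil, Finset.sum_insert (by simp)]
  by_cases hx : ∃ y, x < y
  · obtain ⟨a, b, hxa, hxb, hab, hcov⟩ := exists_two_covers hf hx
    have hU : (Finset.univ.filter fun y => x < y) =
        (Finset.univ.filter fun y => a ≤ y) ∪ (Finset.univ.filter fun y => b ≤ y) := by
      ext y
      simp only [Finset.mem_filter_univ, Finset.mem_union]
      exact ⟨hcov y, fun h => h.elim hxa.trans_le hxb.trans_le⟩
    have hI : (Finset.univ.filter fun y => a ⊔ b ≤ y) =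
        (Finset.univ.filter fun y => a ≤ y) ∩ (Finset.univ.filter fun y => b ≤ y) := by
      ext y
      simp
    have h := Finset.sum_union_inter (f := β) (s₁ := Finset.univ.filter fun y => a ≤ y)
      (s₂ := Finset.univ.filter fun y => b ≤ y)
    rw [← hU, ← hI, hβ, hβ, hβ] at h
    -- Here `β x` is `g x - g a` if `a = b`, and `g x - g a - g b + g (a ⊔ b)` otherwise.
    by_cases hne : a = b
    · subst hne
      rw [sup_idem] at h
      linarith [hanti hxa.le]
    · have := hsup a b
      rw [hab hne] at this
      linarith
  · rw [Finset.filter_false_of_mem (fun y _ h => hx ⟨y, h⟩), Finset.sum_empty, add_zero] at hsum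
    exact hsum ▸ hg x

open scoped Classical in
/-- The generalized submodular inequality for the elements `z x`, `x ∈ V`. -/
theorem exists_add_ncard_le_sub_sum [Fintype L] {α : Type*}
    (hf : ∀ x y, x ≤ y ↔ f₁ x ≤ f₁ y ∧ f₂ x ≤ f₂ y)
    {φ : L → Set α} {ρ ρ' : L → ℤ} {z : L → L} {N : ℤ} {β : L → ℤ}
    (hφ : ∀ x, (φ x).Finite)
    (hsub : ∀ x y, ρ (x ⊔ y) + ρ (x ⊓ y) + ((φ x ∩ φ y) \ φ (x ⊓ y)).ncard ≤ ρ x + ρ y)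
    (hz : ∀ x, x ≤ z x) (hρz : ∀ x, ρ (z x) = ρ' x) (hρ' : ∀ x y, x ≤ y → ρ' x ≤ ρ y)
    (hβ : ∀ x, ∑ y with x ≤ y, β y = N - ρ' x) {J : Set α}
    (V : Finset L) (hV : V.Nonempty) (hJV : ∀ x ∈ V, J ⊆ φ (z x))
    {U : Finset L} (hU : ∀ y, y ∈ U ↔ ∃ x ∈ V, x ≤ y) :
    ∃ w, ρ w + (J \ φ w).ncard ≤ N - ∑ y ∈ U, β y := by
  obtain rfl : (Finset.univ.filter fun y => ∃ x ∈ V, x ≤ y) = U := by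
    ext y
    simp [hU]
  -- The witness `w` is the meet of the `z x`; the added clause records what distributivity says
  -- about joins with it.
  suffices h : V.Nonempty → (∀ x ∈ V, J ⊆ φ (z x)) →
      ∃ w, (ρ w + (J \ φ w).ncard ≤ N - ∑ y with ∃ x ∈ V, x ≤ y, β y) ∧
        ∀ a t, (∀ x ∈ V, a ≤ z x ⊔ t) → a ≤ w ⊔ t by
    obtain ⟨w, hw, -⟩ := h hV hJV
    exact ⟨w, hw⟩
  clear hV hJV hU
  induction V using Finset.induction_on_max_value f₁ with
  | empty => simp
  | insert b V hbV hmax ih =>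
    intro _ hJV
    have hJb : J ⊆ φ (z b) := hJV b (Finset.mem_insert_self _ _)
    rcases V.eq_empty_or_nonempty with rfl | hV
    · refine ⟨z b, ?_, by simp⟩
      simp [hβ, hρz, Set.sdiff_eq_empty.2 hJb]
    obtain ⟨w, hw, hw'⟩ := ih hV fun x hx => hJV x (Finset.mem_insert_of_mem hx)
    -- Since `b` has the largest `f₁` and `a` the least `f₂`, the upper sets of `V` and of `b`
    -- intersect in that of the single element `a ⊔ b`.
    obtain ⟨a, haV, ha⟩ := V.exists_min_image f₂ hV
    have hab : ∀ x ∈ V, a ≤ x ⊔ b := fun x hx => (hf _ _).2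
      ⟨(hmax a haV).trans ((hf _ _).1 le_sup_right).1,
        (ha x hx).trans ((hf _ _).1 le_sup_left).2⟩
    refine ⟨w ⊓ z b, ?_, fun c t hc => ?_⟩
    · have hU : (Finset.univ.filter fun y => ∃ x ∈ insert b V, x ≤ y) =
          (Finset.univ.filter fun y => ∃ x ∈ V, x ≤ y) ∪ (Finset.univ.filter fun y => b ≤ y) := by
        ext y
        simp [or_comm]
      have hI : (Finset.univ.filter fun y => a ⊔ b ≤ y) =
          (Finset.univ.filter fun y => ∃ x ∈ V, x ≤ y) ∩ (Finset.univ.filter fun y => b ≤ y) := by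
        ext y
        simp only [Finset.mem_filter_univ, Finset.mem_inter, sup_le_iff]
        exact and_congr_left fun hby => ⟨fun h => ⟨a, haV, h⟩,
          fun ⟨x, hx, hxy⟩ => (hab x hx).trans (sup_le hxy hby)⟩
      have h := Finset.sum_union_inter (f := β)
        (s₁ := Finset.univ.filter fun y => ∃ x ∈ V, x ≤ y)
        (s₂ := Finset.univ.filter fun y => b ≤ y)
      rw [← hU, ← hI, hβ, hβ] at h
      have hle : a ⊔ b ≤ w ⊔ z b := hw' _ _ fun x hx =>
        (sup_le (hab x hx) le_sup_right).trans (sup_le_sup (hz x) (hz b))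
      have h₁ := hρ' _ _ hle
      have h₂ := hsub w (z b)
      rw [hρz] at h₂
      have h₃ : (J \ φ (w ⊓ z b)).ncard ≤
          (J \ φ w).ncard + ((φ w ∩ φ (z b)) \ φ (w ⊓ z b)).ncard := by
        refine (Set.ncard_le_ncard (fun e he => ?_) (((hφ _).subset hJb).sdiff.union
          ((hφ w).inter_of_left _).sdiff)).trans (Set.ncard_union_le _ _)
        by_cases hew : e ∈ φ w
        · exact Or.inr ⟨⟨hew, hJb he.1⟩, he.2⟩
        · exact Or.inl ⟨he.1, hew⟩
      push_cast [← @Nat.cast_le ℤ] at h₃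
      linarith
    · rw [sup_inf_right]
      exact le_inf (hw' _ _ fun x hx => hc x (Finset.mem_insert_of_mem hx))
        (hc b (Finset.mem_insert_self _ _))

end Sums

/-! ### Hall's theorem and the transversal presentation. -/

namespace Matroid

section Transversal

/-- Hall's theorem for partial transversals. -/
theorem isPartialTransversal_iff_forall_ncard_le {α : Type*} {ι : Type*} [Finite ι]
    {A : ι → Set α} {I : Set α} (hI : I.Finite) :
    IsPartialTransversal A I ↔ ∀ J ⊆ I, J.ncard ≤ {j | (A j ∩ J).Nonempty}.ncard := by
  classical
  cases nonempty_fintype ι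
  have hall := Finset.all_card_le_biUnion_card_iff_exists_injective
    (fun e : I => Finset.univ.filter fun j => (e : α) ∈ A j)
  simp only [Finset.mem_filter_univ] at hall
  rw [IsPartialTransversal, ← hall]
  have key : ∀ s : Finset I, {j | (A j ∩ ((↑) '' (s : Set I) : Set α)).Nonempty}.ncard =
      (s.biUnion fun e : I => Finset.univ.filter fun j => (e : α) ∈ A j).card := fun s => by
    rw [← Set.ncard_coe_finset]
    congr 1
    ext j
    simp [Set.Nonempty, and_comm]
  have hcard : ∀ s : Finset I, ((↑) '' (s : Set I) : Set α).ncard = s.card := fun s => by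
    rw [Set.ncard_image_of_injective _ Subtype.val_injective, Set.ncard_coe_finset]
  refine ⟨fun h J hJ => ?_, fun h s => ?_⟩
  · have : Finite I := hI
    have hs := h (Set.toFinite ((↑) ⁻¹' J : Set I)).toFinset
    rw [← key, ← hcard] at hs
    simpa [Set.inter_eq_self_of_subset_right hJ] using hs
  · rw [← key, ← hcard]
    exact h _ (by simp)

theorem isTransversal_of_finite {α : Type*} {M : Matroid α} {ι : Type*} [Finite ι]
    (A : ι → Set α) (hA : ∀ j, A j ⊆ M.E) (h : ∀ I, M.Indep I ↔ IsPartialTransversal A I) :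
    M.IsTransversal := by
  obtain ⟨n, ⟨e⟩⟩ := Finite.exists_equiv_fin ι
  refine ⟨n, A ∘ e.symm, fun j => hA _, fun I => (h I).trans ⟨?_, ?_⟩⟩
  · rintro ⟨f, hf, hfA⟩
    exact ⟨e ∘ f, e.injective.comp hf, fun x => by simpa using hfA x⟩
  · rintro ⟨f, hf, hfA⟩
    exact ⟨e.symm ∘ f, e.symm.injective.comp hf, hfA⟩

theorem ncard_sigma_fin {L : Type*} [Fintype L] (b : L → ℕ) (P : L → Prop) [DecidablePred P] :
    {p : Σ y, Fin (b y) | P p.1}.ncard = ∑ y with P y, b y := by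
  have : {p : Σ y, Fin (b y) | P p.1} =
      ((Finset.univ.filter P).sigma fun y => (Finset.univ : Finset (Fin (b y)))) := by
    ext p
    simp
  rw [this, Set.ncard_coe_finset, Finset.card_sigma]
  simp

end Transversal

/-- A matroid is transversal if its independent sets are cut out by a family of sets, indexed by a
distributive lattice of dimension at most two, with upper bounds that are strongly submodular. -/
theorem isTransversal_of_distribLattice {α : Type*} {L : Type*} [DistribLattice L] [Finite L]
    {C₁ C₂ : Type*} [LinearOrder C₁] [LinearOrder C₂] {f₁ : L → C₁} {f₂ : L → C₂}
    (hf : ∀ x y, x ≤ y ↔ f₁ x ≤ f₁ y ∧ f₂ x ≤ f₂ y) (M : Matroid α) [M.Finite]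
    {φ : L → Set α} (hφ : Monotone φ) (hφE : ∀ x, φ x ⊆ M.E) {ρ : L → ℤ} (hρ : ∀ x, 0 ≤ ρ x)
    (hρ0 : ∃ x, ρ x = 0)
    (hsub : ∀ x y, ρ (x ⊔ y) + ρ (x ⊓ y) + ((φ x ∩ φ y) \ φ (x ⊓ y)).ncard ≤ ρ x + ρ y)
    (hM : ∀ I ⊆ M.E, M.Indep I ↔ ∀ x, ((I ∩ φ x).ncard : ℤ) ≤ ρ x) : M.IsTransversal := by
  classical
  cases nonempty_fintype L
  have hfin : ∀ {X : Set α}, X ⊆ M.E → X.Finite := fun h => M.ground_finite.subset h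
  have hmin : ∀ x, ∃ w, x ≤ w ∧ ∀ y, x ≤ y → ρ w ≤ ρ y := fun x =>
    Set.exists_min_image (Set.Ici x) ρ (Set.toFinite _) ⟨x, le_rfl⟩
  choose z hz hzmin using hmin
  -- Any `N` that bounds every `ρ x` and `M.E.ncard` would do.
  set N : ℤ := M.E.ncard + ∑ x, ρ x with hN
  have hρN : ∀ x, ρ x ≤ N := fun x => by
    have := Finset.single_le_sum (fun y _ => hρ y) (Finset.mem_univ x)
    omega
  have hanti : Antitone fun x => N - ρ (z x) := fun x y hxy => by
    have := hzmin x (z y) (hxy.trans (hz y))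
    dsimp only
    omega
  obtain ⟨β, hβ⟩ := exists_sum_Ici_eq fun x => N - ρ (z x)
  have hβ0 : ∀ x, 0 ≤ β x := nonneg_of_sum_Ici_eq hf hβ (fun x => sub_nonneg.2 (hρN _)) hanti
    fun x y => by
      have h₁ := hsub (z x) (z y)
      have h₂ := hzmin (x ⊔ y) _ (sup_le_sup (hz x) (hz y))
      have h₃ := hzmin (x ⊓ y) _ (inf_le_inf (hz x) (hz y))
      omega
  -- At the bottom element the minimum of `ρ` is zero.
  have hβN : ∑ y, β y = N := by
    obtain ⟨x, hx⟩ := hρ0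
    have : Nonempty L := ⟨x⟩
    obtain ⟨b, hb⟩ : ∃ b : L, ∀ y, b ≤ y :=
      ⟨Finset.univ.inf' Finset.univ_nonempty id, fun y => Finset.inf'_le id (Finset.mem_univ y)⟩
    have h := hβ b
    rw [Finset.filter_true_of_mem fun y _ => hb y] at h
    have h₁ := hzmin b x (hb x)
    have h₂ := hρ (z b)
    omega
  let A : (Σ y, Fin (β y).toNat) → Set α := fun p => M.E \ φ (z p.1)
  have hcount : ∀ J ⊆ M.E, ({j | (A j ∩ J).Nonempty}.ncard : ℤ) =
      N - ∑ y with J ⊆ φ (z y), β y := fun J hJ => by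
    have : {j | (A j ∩ J).Nonempty} = {j | ¬ J ⊆ φ (z j.1)} := by
      ext j
      simp only [Set.mem_ofPred_eq, Set.not_subset]
      exact ⟨fun ⟨e, he, heJ⟩ => ⟨e, heJ, he.2⟩, fun ⟨e, heJ, he⟩ => ⟨e, ⟨hJ heJ, he⟩, heJ⟩⟩
    rw [this, ncard_sigma_fin (fun y => (β y).toNat) fun y => ¬ J ⊆ φ (z y), Nat.cast_sum,
      eq_sub_iff_add_eq, add_comm, ← hβN]
    simp only [Int.toNat_of_nonneg (hβ0 _)]
    exact Finset.sum_filter_add_sum_filter_not _ _ _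
  refine isTransversal_of_finite A (fun _ => Set.sdiff_subset) fun I => ?_
  by_cases hIE : I ⊆ M.E
  swap
  · refine iff_of_false (fun h => hIE h.subset_ground) fun ⟨f, _, hfA⟩ => hIE fun e he => ?_
    exact (hfA ⟨e, he⟩).1
  rw [hM I hIE, isPartialTransversal_iff_forall_ncard_le (hfin hIE)]
  refine ⟨fun h J hJI => ?_, fun h x => ?_⟩
  · have hJE := hJI.trans hIE
    rw [← @Nat.cast_le ℤ, hcount J hJE]
    obtain ⟨V, hVJ⟩ : ∃ V, V = Finset.univ.filter fun y => J ⊆ φ (z y) := ⟨_, rfl⟩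
    rw [← hVJ]
    rcases V.eq_empty_or_nonempty with hV | hV
    · rw [hV, Finset.sum_empty, sub_zero]
      have h₁ := Set.ncard_le_ncard hJE (hfin subset_rfl)
      have h₂ := Finset.sum_nonneg fun y (_ : y ∈ Finset.univ) => hρ y
      omega
    · obtain ⟨w, hw⟩ := exists_add_ncard_le_sub_sum hf (fun x => hfin (hφE x)) hsub hz
        (fun _ => rfl) hzmin hβ V hV (J := J) (fun x hx => by simpa [hVJ] using hx)
        (U := Finset.univ.filter fun y => ∃ x ∈ V, x ≤ y) (by simp)
      -- As `β ≥ 0`, passing to the upper set generated by `V` only strengthens the bound to be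
      -- proved.
      have h₁ : ∑ y ∈ V, β y ≤ ∑ y with ∃ x ∈ V, x ≤ y, β y :=
        Finset.sum_le_sum_of_subset_of_nonneg
          (fun y hy => (Finset.mem_filter_univ _).2 ⟨y, hy, le_rfl⟩) fun y _ _ => hβ0 y
      have h₂ := Set.ncard_le_ncard (Set.inter_subset_inter_left (φ w) hJI)
        ((hfin hIE).inter_of_left _)
      have h₃ := Set.ncard_inter_add_ncard_sdiff_eq_ncard J (φ w) (hfin hJE)
      have h₄ := h w
      omega
  -- Hall's condition for `J = I ∩ φ x` suffices: `J ⊆ φ (z y)` for every `y ≥ x`, and these `y`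
  -- have total weight `N - ρ (z x)`.
  · have h₁ := h _ (Set.inter_subset_left (t := φ x))
    rw [← @Nat.cast_le ℤ, hcount _ (Set.inter_subset_left.trans hIE)] at h₁
    have h₂ : (∑ y with x ≤ y, β y) ≤ ∑ y with I ∩ φ x ⊆ φ (z y), β y :=
      Finset.sum_le_sum_of_subset_of_nonneg (fun y hy => (Finset.mem_filter_univ _).2
        (Set.inter_subset_right.trans (hφ (((Finset.mem_filter_univ _).1 hy).trans (hz y)))))
        fun y _ _ => hβ0 y
    rw [hβ] at h₂
    have h₃ := hzmin x x le_rfl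
    omega

end Matroid

/-! ### Cyclic flats: duality and rank. -/

namespace Matroid

section CyclicFlats

variable {α : Type u} {M : Matroid α} {X Y : Set α}

/-- This form suits duality: complementation exchanges the two closure conditions, by
`mem_closure_dual_compl_iff`. -/
theorem isCyclicFlat_iff_forall_mem_closure :
    M.IsCyclicFlat X ↔ X ⊆ M.E ∧ M.closure X ⊆ X ∧ ∀ e ∈ X, e ∈ M.closure (X \ {e}) := by
  constructor
  · refine fun h => ⟨h.1.subset_ground, h.1.closure.subset, fun e he => ?_⟩
    have := h.2 e
    rw [restrict_isColoop_iff h.1.subset_ground] at this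
    tauto
  · rintro ⟨hE, hcl, h⟩
    refine ⟨isFlat_iff_closure_eq.2 (hcl.antisymm (M.subset_closure X hE)), fun e he => ?_⟩
    rw [restrict_isColoop_iff hE] at he
    exact he.1 (h e he.2)

theorem mem_closure_dual_compl_iff {e : α} (hX : X ⊆ M.E) (he : e ∈ X) :
    e ∈ M✶.closure (M.E \ X) ↔ e ∉ M.closure (X \ {e}) := by
  have h := contract_isLoop_iff_mem_closure (M := M✶) (C := M.E \ X) (e := e)
  rw [← dual_delete, ← restrict_compl, Set.sdiff_sdiff_cancel_left hX, dual_isLoop_iff_isColoop,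
    restrict_isColoop_iff hX] at h
  simp only [he, and_true, Set.mem_sdiff, not_true_eq_false, and_false, not_false_eq_true] at h
  exact h.symm

/-- The complements of the cyclic flats are the cyclic flats of the dual. -/
theorem IsCyclicFlat.dual_compl (h : M.IsCyclicFlat X) : M✶.IsCyclicFlat (M.E \ X) := by
  rw [isCyclicFlat_iff_forall_mem_closure] at *
  obtain ⟨hE, hcl, hX⟩ := h
  refine ⟨Set.sdiff_subset, fun e he => ?_, fun e he => ?_⟩
  · refine ⟨(M✶.closure_subset_ground _) he, fun heX => ?_⟩
    exact (mem_closure_dual_compl_iff hE heX).1 he (hX e heX)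
  · have hi : insert e X ⊆ M.E := Set.insert_subset he.1 hE
    have hd : (M.E \ X) \ {e} = M.E \ insert e X := by
      ext; simp [and_assoc, and_comm]
    rw [hd, mem_closure_dual_compl_iff hi (Set.mem_insert _ _),
      Set.insert_sdiff_self_of_notMem he.2]
    exact fun h => he.2 (hcl h)

/-- The lattice of cyclic flats of the dual is the order dual of the lattice of cyclic flats. -/
def cyclicFlatsDualIso (M : Matroid α) : M✶.CyclicFlats ≃o M.CyclicFlatsᵒᵈ where
  toFun X := OrderDual.toDual ⟨M.E \ X.1, by
    have := X.2.dual_compl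
    rwa [dual_dual] at this⟩
  invFun X := ⟨M.E \ (OrderDual.ofDual X).1, (OrderDual.ofDual X).2.dual_compl⟩
  left_inv X := Subtype.ext (Set.sdiff_sdiff_cancel_left X.2.1.subset_ground)
  right_inv X := Subtype.ext (Set.sdiff_sdiff_cancel_left (OrderDual.ofDual X).2.1.subset_ground)
  map_rel_iff' {X Y} := by
    refine ⟨fun h => ?_, fun h => Set.sdiff_subset_sdiff_right h⟩
    have h' : M.E \ (M.E \ X.1) ⊆ M.E \ (M.E \ Y.1) := Set.sdiff_subset_sdiff_right h
    rw [Set.sdiff_sdiff_cancel_left (show X.1 ⊆ M.E from X.2.1.subset_ground),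
      Set.sdiff_sdiff_cancel_left (show Y.1 ⊆ M.E from Y.2.1.subset_ground)] at h'
    exact h'

theorem isCyclicFlat_loops (M : Matroid α) : M.IsCyclicFlat M.loops :=
  isCyclicFlat_iff_forall_mem_closure.2
    ⟨M.loops_subset_ground, M.closure_loops.subset, fun _ he => M.closure_subset_closure (Set.empty_subset _) he⟩

theorem IsCircuit.isCyclicFlat_closure {C : Set α} (hC : M.IsCircuit C) :
    M.IsCyclicFlat (M.closure C) := by
  rw [isCyclicFlat_iff]
  refine ⟨M.isFlat_closure C, fun e he => ?_⟩
  have hCcl := M.subset_closure C hC.subset_ground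
  by_cases heC : e ∈ C
  · exact ⟨C, hC, hCcl, heC⟩
  · obtain ⟨C', hC's, hC', heC'⟩ := exists_isCircuit_of_mem_closure he heC
    exact ⟨C', hC', hC's.trans (Set.insert_subset he hCcl), heC'⟩

/-- A set is independent if it meets no cyclic flat in more elements than the rank of the flat. -/
theorem indep_iff_forall_isCyclicFlat [M.Finite] {I : Set α} (hI : I ⊆ M.E) :
    M.Indep I ↔ ∀ X, M.IsCyclicFlat X → (I ∩ X).encard ≤ M.eRk X := by
  refine ⟨fun h X _ => (h.inter_right X).encard_le_eRk_of_subset Set.inter_subset_right,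
    fun h => ?_⟩
  by_contra hcon
  obtain ⟨C, hCI, hC⟩ := ((not_indep_iff hI).1 hcon).exists_isCircuit_subset
  have h₁ := (Set.encard_le_encard (Set.subset_inter hCI
    (M.subset_closure C hC.subset_ground))).trans (h _ hC.isCyclicFlat_closure)
  rw [eRk_closure_eq, ← hC.eRk_add_one_eq] at h₁
  have h₂ : M.eRk C ≠ ⊤ := ne_top_of_le_ne_top (M.set_finite C hC.subset_ground).encard_lt_top.ne
    (M.eRk_le_encard C)
  exact absurd h₁ (ENat.lt_add_one_iff h₂ |>.2 le_rfl).not_ge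

/-- An element of `X ∩ Y` in no circuit inside `X ∩ Y` is a coloop there, so all of these extend a
basis of the meet to an independent set. Submodularity of rank does the rest. -/
theorem eRk_closure_union_add_le (M : Matroid α) (X Y : Set α) :
    M.eRk (M.closure (X ∪ Y)) + M.eRk (⋃₀ {C | M.IsCircuit C ∧ C ⊆ X ∩ Y}) +
      (((X ∩ Y) ∩ M.E) \ ⋃₀ {C | M.IsCircuit C ∧ C ⊆ X ∩ Y}).encard ≤ M.eRk X + M.eRk Y := by
  set K := ⋃₀ {C | M.IsCircuit C ∧ C ⊆ X ∩ Y} with hK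
  have hKXY : K ⊆ X ∩ Y := Set.sUnion_subset fun C hC => hC.2
  obtain ⟨I, hI⟩ := M.exists_isBasis' K
  have hIXY : I ∪ ((X ∩ Y) ∩ M.E) \ K ⊆ X ∩ Y := Set.union_subset (hI.subset.trans hKXY)
    (Set.sdiff_subset.trans Set.inter_subset_left)
  have hind : M.Indep (I ∪ ((X ∩ Y) ∩ M.E) \ K) := by
    by_contra hcon
    rw [not_indep_iff (Set.union_subset hI.indep.subset_ground
      (Set.sdiff_subset.trans Set.inter_subset_right))] at hcon
    obtain ⟨C, hCs, hC⟩ := hcon.exists_isCircuit_subset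
    have hCK : C ⊆ K := Set.subset_sUnion_of_mem (show C ∈ {C | _} from ⟨hC, hCs.trans hIXY⟩)
    exact hC.not_indep (hI.indep.subset fun e he => (hCs he).elim id fun h => absurd (hCK he) h.2)
  have h := hind.encard_le_eRk_of_subset hIXY
  rw [Set.encard_union_eq (Set.disjoint_sdiff_right.mono_left hI.subset), hI.encard_eq_eRk] at h
  rw [eRk_closure_eq, add_assoc]
  calc _ ≤ M.eRk (X ∪ Y) + M.eRk (X ∩ Y) := by gcongr
    _ ≤ _ := by rw [add_comm]; exact M.eRk_inter_add_eRk_union_le X Y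

end CyclicFlats

end Matroid

/-! ### Minors and their duals. -/

namespace Matroid

section Minors

variable {α : Type u} {M N : Matroid α}

theorem IsMinor.dual (h : N.IsMinor M) : N✶.IsMinor M✶ := by
  obtain ⟨C, D, -, -, hdj, rfl⟩ := h.exists_eq_contract_delete_disjoint
  exact ⟨D, C, by rw [dual_contract_delete, ← contract_delete_comm _ hdj.symm]⟩

/-- All minors of a matroid are transversal if its lattice of cyclic flats is distributive and
has dimension at most two. -/
theorem IsMinor.isTransversal_of_cyclicFlats {L : Type*} [DistribLattice L]
    {C₁ C₂ : Type*} [LinearOrder C₁] [LinearOrder C₂] {f₁ : L → C₁} {f₂ : L → C₂}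
    (hf : ∀ x y, x ≤ y ↔ f₁ x ≤ f₁ y ∧ f₂ x ≤ f₂ y) [M.Finite] (i : M.CyclicFlats ≃o L)
    (hN : N.IsMinor M) : N.IsTransversal := by
  have hfin : ∀ {X : Set α}, X ⊆ M.E → X.Finite := fun h => M.ground_finite.subset h
  have : Finite M.CyclicFlats :=
    (M.ground_finite.finite_subsets.subset fun X hX => hX.1.subset_ground :
      {X | M.IsCyclicFlat X}.Finite)
  have : Finite L := Finite.of_equiv _ i.toEquiv
  have hNM := hN.subset
  have : N.Finite := ⟨M.ground_finite.subset hNM⟩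
  obtain ⟨C, D, hC, hD, hdj, rfl⟩ := hN.exists_eq_contract_delete_disjoint
  set N := M ／ C ＼ D with hNdef
  obtain ⟨B, hB⟩ := M.exists_isBasis C
  have hBfin : B.Finite := hfin hB.indep.subset_ground
  have hNC : Disjoint N.E C := Set.disjoint_left.2 fun e he => he.1.2
  have hNB : Disjoint N.E B := hNC.mono_right hB.subset
  have hrfin : ∀ X, M.eRk X ≠ ⊤ := fun X =>
    ((M.eRk_le_eRank X).trans_lt (M.eRank_lt_top_iff.2 inferInstance)).ne
  let r : Set α → ℕ := fun X => (M.eRk X).toNat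
  have hr : ∀ X, (r X : ℕ∞) = M.eRk X := fun X => ENat.natCast_toNat (hrfin X)
  let F : L → Set α := fun x => (i.symm x).1
  have hF : ∀ x, M.IsCyclicFlat (F x) := fun x => (i.symm x).2
  have hFi : ∀ X (hX : M.IsCyclicFlat X), F (i ⟨X, hX⟩) = X := fun X hX =>
    congrArg Subtype.val (i.symm_apply_apply (⟨X, hX⟩ : M.CyclicFlats))
  have hFE : ∀ x, F x ⊆ M.E := fun x => (hF x).1.subset_ground
  have hmono : Monotone F := fun x y h => i.symm.monotone h
  have hBr : ∀ x, (B ∩ F x).ncard ≤ r (F x) := fun x => by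
    rw [← Nat.cast_le (α := ℕ∞), hr, (hBfin.inter_of_left _).cast_ncard_eq]
    exact (hB.indep.inter_right _).encard_le_eRk_of_subset Set.inter_subset_right
  refine isTransversal_of_distribLattice hf N (φ := fun x => F x ∩ N.E)
    (ρ := fun x => (r (F x) : ℤ) - (B ∩ F x).ncard)
    (fun x y h => Set.inter_subset_inter_left _ (hmono h)) (fun x => Set.inter_subset_right)
    (fun x => sub_nonneg.2 (by exact_mod_cast hBr x)) ?_ (fun x y => ?_) fun I hI => ?_
  · refine ⟨i ⟨M.loops, M.isCyclicFlat_loops⟩, ?_⟩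
    have h₀ : r M.loops = 0 := by simp [r]
    simp only [hFi, h₀, hB.indep.disjoint_loops.inter_eq]
    simp
  · have hsup : F (x ⊔ y) = M.closure (F x ∪ F y) := by
      simp only [F, map_sup]
      rfl
    have hinf : F (x ⊓ y) = ⋃₀ {C | M.IsCircuit C ∧ C ⊆ F x ∩ F y} := by
      simp only [F, map_inf]
      rfl
    have h₁ := M.eRk_closure_union_add_le (F x) (F y)
    rw [← hsup, ← hinf, ← hr, ← hr, ← hr, ← hr,
      Set.inter_eq_self_of_subset_left (Set.inter_subset_left.trans (hFE x)),
      ← (hfin (Set.sdiff_subset.trans (Set.inter_subset_left.trans (hFE x)))).cast_ncard_eq] at h₁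
    norm_cast at h₁
    set K := F (x ⊓ y) with hK
    have hKxy : K ⊆ F x ∩ F y := Set.subset_inter (hmono inf_le_left) (hmono inf_le_right)
    have hxy : F x ∪ F y ⊆ F (x ⊔ y) := Set.union_subset (hmono le_sup_left) (hmono le_sup_right)
    have hS : ((F x ∩ F y) \ K).Finite :=
      hfin (Set.sdiff_subset.trans (Set.inter_subset_left.trans (hFE x)))
    -- The surplus `(F x ∩ F y) \ K` contains disjoint parts in `N.E` and in `B`; the latter pays
    -- for the failure of `|B ∩ F|` to be modular at the meet.
    have h₂ : (((F x ∩ N.E) ∩ (F y ∩ N.E)) \ (K ∩ N.E)).ncard + (B ∩ ((F x ∩ F y) \ K)).ncard ≤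
        ((F x ∩ F y) \ K).ncard := by
      rw [← Set.ncard_union_eq (Set.disjoint_left.2 fun e he heB =>
        Set.disjoint_left.1 hNB he.1.1.2 heB.1)
        (hS.subset fun e he => ⟨⟨he.1.1.1, he.1.2.1⟩, fun h => he.2 ⟨h, he.1.1.2⟩⟩)
        (hBfin.inter_of_left _)]
      refine Set.ncard_le_ncard (Set.union_subset ?_ Set.inter_subset_right) hS
      exact fun e he => ⟨⟨he.1.1.1, he.1.2.1⟩, fun h => he.2 ⟨h, he.1.1.2⟩⟩
    have h₃ := Set.ncard_union_add_ncard_inter (B ∩ F x) (B ∩ F y)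
      (hBfin.inter_of_left _) (hBfin.inter_of_left _)
    rw [← Set.inter_union_distrib_left, ← Set.inter_inter_distrib_left] at h₃
    have h₄ := Set.ncard_le_ncard (Set.inter_subset_inter_right B hxy) (hBfin.inter_of_left _)
    have h₅ := Set.ncard_inter_add_ncard_sdiff_eq_ncard (B ∩ (F x ∩ F y)) K
      (hBfin.inter_of_left _)
    rw [Set.inter_assoc, Set.inter_eq_self_of_subset_right hKxy, ← Set.inter_sdiff_assoc] at *
    omega
  · have hIC : Disjoint C I := (hNC.mono_left hI).symm
    have hID : Disjoint I D := Set.disjoint_left.2 fun e he => (hI he).2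
    have hIB : Disjoint I B := hNB.mono_left hI
    have hIfin : I.Finite := hfin (hI.trans hNM)
    rw [hNdef, delete_indep_iff, hB.contract_indep_iff, and_iff_left hID, and_iff_left hIC,
      indep_iff_forall_isCyclicFlat (Set.union_subset (hI.trans hNM) hB.indep.subset_ground)]
    have hF' : (∀ X, M.IsCyclicFlat X → ((I ∪ B) ∩ X).encard ≤ M.eRk X) ↔
        ∀ x, ((I ∪ B) ∩ F x).encard ≤ M.eRk (F x) := by
      exact ⟨fun h x => h _ (hF x), fun h X hX => hFi X hX ▸ h (i ⟨X, hX⟩)⟩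
    rw [hF']
    refine forall_congr' fun x => ?_
    have hIF : I ∩ (F x ∩ N.E) = I ∩ F x := by
      rw [← Set.inter_assoc, Set.inter_eq_self_of_subset_left (Set.inter_subset_left.trans hI)]
    rw [← hr, ← ((hIfin.union hBfin).inter_of_left _).cast_ncard_eq, Nat.cast_le,
      Set.union_inter_distrib_right, Set.ncard_union_eq
      (hIB.mono Set.inter_subset_left Set.inter_subset_left) (hIfin.inter_of_left _)
      (hBfin.inter_of_left _), hIF]
    omega

/-- All minors of a matroid and their duals are transversal if its lattice of cyclic flats is
distributive and has dimension at most two. -/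
theorem IsMinor.isTransversal_and_dual_of_cyclicFlats {L : Type*} [DistribLattice L]
    {C₁ C₂ : Type*} [LinearOrder C₁] [LinearOrder C₂] {f₁ : L → C₁} {f₂ : L → C₂}
    (hf : ∀ x y, x ≤ y ↔ f₁ x ≤ f₁ y ∧ f₂ x ≤ f₂ y) [M.Finite] (i : M.CyclicFlats ≃o L)
    (hN : N.IsMinor M) : N.IsTransversal ∧ N✶.IsTransversal := by
  refine ⟨hN.isTransversal_of_cyclicFlats hf i, ?_⟩
  have hf' : ∀ x y : Lᵒᵈ, x ≤ y ↔
      OrderDual.toDual (f₁ (OrderDual.ofDual x)) ≤ OrderDual.toDual (f₁ (OrderDual.ofDual y)) ∧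
      OrderDual.toDual (f₂ (OrderDual.ofDual x)) ≤ OrderDual.toDual (f₂ (OrderDual.ofDual y)) :=
    fun x y => hf (OrderDual.ofDual y) (OrderDual.ofDual x)
  exact hN.dual.isTransversal_of_cyclicFlats hf' (M.cyclicFlatsDualIso.trans i.dual)

end Minors

end Matroid

/-! ### From dimension to coordinates, and the conclusion. -/

theorem exists_linearOrder_of_orderDimension_le_two {P : Type u} [PartialOrder P]
    (h : orderDimension P ≤ 2) :
    ∃ (C₁ C₂ : Type u) (_ : LinearOrder C₁) (_ : LinearOrder C₂) (f₁ : P → C₁) (f₂ : P → C₂),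
      ∀ x y, x ≤ y ↔ f₁ x ≤ f₁ y ∧ f₂ x ≤ f₂ y := by
  have hne : {d : ℕ∞ | ∃ n : ℕ, d = n ∧ EmbedsInChains P n}.Nonempty := by
    by_contra hcon
    rw [orderDimension, Set.not_nonempty_iff_eq_empty.1 hcon, sInf_empty] at h
    exact absurd h (by decide)
  obtain ⟨n, hn, C, hC, ⟨e⟩⟩ := csInf_mem hne
  have hn2 : n ≤ 2 := by
    rw [orderDimension, hn] at h
    exact_mod_cast h
  have he : ∀ x y, x ≤ y ↔ ∀ k, e x k ≤ e y k := fun x y => e.le_iff_le.symm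
  -- Dimensions zero and one are padded to two coordinates, by one-point chains or by repeating the
  -- chain.
  interval_cases n
  · exact ⟨PUnit, PUnit, inferInstance, inferInstance, fun _ => ⟨⟩, fun _ => ⟨⟩, by simp [he]⟩
  · exact ⟨C 0, C 0, hC 0, hC 0, (e · 0), (e · 0), by simp [he]⟩
  · exact ⟨C 0, C 1, hC 0, hC 1, (e · 0), (e · 1), by simp [he, Fin.forall_fin_two]⟩

theorem mainTheorem4 :
    (∀ (α : Type v) (M : Matroid α), M.Finite →
      (∀ X Y Z : M.CyclicFlats, X ⊓ (Y ⊔ Z) = (X ⊓ Y) ⊔ (X ⊓ Z)) →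
      orderDimension M.CyclicFlats ≤ 2 →
        M.IsTransversal ∧ M.dual.IsTransversal ∧
          ∀ N : Matroid α, N.IsMinor M → N.IsTransversal ∧ N.dual.IsTransversal) ∧
    (∀ (L : Type u) [DistribLattice L] [Finite L],
      orderDimension L ≤ 2 → IsTrLattice.{u, v} L) := by
  refine ⟨fun α M hM hdist hdim => ?_, fun L _ _ hdim α M hM ⟨i⟩ => ?_⟩
  · let : DistribLattice M.CyclicFlats :=
      DistribLattice.ofInfSupLe fun X Y Z => (hdist X Y Z).le
    obtain ⟨C₁, C₂, _, _, f₁, f₂, hf⟩ := exists_linearOrder_of_orderDimension_le_two hdim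
    have h : ∀ N : Matroid α, N.IsMinor M → N.IsTransversal ∧ N.dual.IsTransversal := fun N hN =>
      hN.isTransversal_and_dual_of_cyclicFlats hf (OrderIso.refl _)
    exact ⟨(h M .refl).1, (h M .refl).2, h⟩
  · obtain ⟨C₁, C₂, _, _, f₁, f₂, hf⟩ := exists_linearOrder_of_orderDimension_le_two hdim
    exact Matroid.IsMinor.refl.isTransversal_of_cyclicFlats hf i
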